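/- Let $G$ and $\hat G$ be real SISO systems with state-space realizations $(A,B,C,D)$ and $(\hat A,\hat B,\hat C,\hat D)$, where $A\in\mathbb{R}^{n\times n}$, $\hat A\in\mathbb{R}^{\hat n\times\hat n}$, $B,\hat B$ are columns, $C,\hat C$ are rows and $D,\hat D$ are scalars. Their transfer functions, also denoted by $G$ and $\hat G$, are $G(z)=C(zI-A)^{-1}B+D$ and $\hat G(z)=\hat C(zI-\hat A)^{-1}\hat B+\hat D$. Let $\alpha$ and $\hat\alpha$ be the characteristic polynomials of $A$ and $\hat A$, and let $\mathcal{K}(A,B)=(B,AB,\dots,A^{n-1}B)$ denote the Kalman controllability matrix. Suppose that $(A,B)$ is controllable, that $(A,C)$ is observable, and that $A$ and $\hat A$ have no common eigenvalue in $\mathbb{C}$. Then $\beta:=G\alpha$ is a polynomial of degree at most $n$. Suppose in addition that $\beta$ and $\hat\alpha$ have no common zero in $\mathbb{C}$ and that $\alpha$ and $\hat G$ have no common zero in $\mathbb{C}$. Then the four matrix equations 1. $AK-K\hat A+B\hat C=0$, 2. $L\,\mathcal{K}(A,B)=\mathcal{K}(A,B\hat D-K\hat B)$, 3. $M\alpha(\hat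 A)=\beta(\hat A)$, 4. $\hat AN-NA+\hat BC=0$ have unique solutions $K\in\mathbb{R}^{n\times\hat n}$, $L\in\mathbb{R}^{n\times n}$, $M\in\mathbb{R}^{\hat n\times\hat n}$, $N\in\mathbb{R}^{\hat n\times n}$ (in 2, $K$ is the solution of 1). The matrix $L$ is invertible. The systems $$(\mathcal A_1,\mathcal B_1,\mathcal C_1,\mathcal D_1)=\left(\begin{pmatrix}A&B\hat C\\0&\hat A\end{pmatrix},\begin{pmatrix}B\hat D\\\hat B\end{pmatrix},\begin{pmatrix}C&D\hat C\end{pmatrix},D\hat D\right),$$ $$(\mathcal A_2,\mathcal B_2,\mathcal C_2,\mathcal D_2)=\left(\begin{pmatrix}A&0\\\hat BC&\hat A\end{pmatrix},\begin{pmatrix}B\\\hat BD\end{pmatrix},\begin{pmatrix}\hat DC&\hat C\end{pmatrix},\hat DD\right)$$ are realizations of $G\hat G$ and $\hat GG$, respectively. The matrix $$T=\begin{pmatrix}L^{-1}&-L^{-1}K\\NL^{-1}&M-NL^{-1}K\end{pmatrix}$$ is invertible and satisfies $\mathcal A_2=T\mathcal A_1T^{-1}$, $\mathcal B_2=T\mathcal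 B_1$, $\mathcal C_2=\mathcal C_1T^{-1}$, $\mathcal D_2=\mathcal D_1$. -/

import Mathlib

open Polynomial

noncomputable section

/-- A real linear time-invariant single-input single-output system
`x⁺ = A x + B u`, `y = C x + D u`, with state coordinates indexed by `ι`. -/
structure SISO (ι : Type*) where
  A : Matrix ι ι ℝ
  B : Matrix ι (Fin 1) ℝ
  C : Matrix (Fin 1) ι ℝ
  D : Matrix (Fin 1) (Fin 1) ℝ

namespace SISO

/-- The transfer function `C (zI - A)⁻¹ B + D`, as a rational function in `z`.
(The matrix `zI - A` over the field of rational functions is always invertible.) -/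
def transfer {ι : Type*} [Fintype ι] [DecidableEq ι] (S : SISO ι) : RatFunc ℝ :=
  (S.C.map RatFunc.C *
      ((RatFunc.X : RatFunc ℝ) • (1 : Matrix ι ι (RatFunc ℝ)) - S.A.map RatFunc.C)⁻¹ *
      S.B.map RatFunc.C + S.D.map RatFunc.C) 0 0

/-- `S₁` is transformed into `S₂` by the state-coordinate change `T`. -/
def TransformsTo {ι : Type*} [Fintype ι] [DecidableEq ι]
    (S₁ : SISO ι) (T : Matrix ι ι ℝ) (S₂ : SISO ι) : Prop :=
  IsUnit T ∧ S₂.A = T * S₁.A * T⁻¹ ∧ S₂.B = T * S₁.B ∧ S₂.C = S₁.C * T⁻¹ ∧ S₂.D = S₁.D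

/-- The series realization of `G Ĝ` (the output of `Ĝ` is the input of `G`),
with state `(x, x̂)`. -/
def seriesLeft {ι κ : Type*} [Fintype ι] [Fintype κ] (G : SISO ι) (Gh : SISO κ) :
    SISO (ι ⊕ κ) where
  A := Matrix.fromBlocks G.A (G.B * Gh.C) 0 Gh.A
  B := Matrix.fromRows (G.B * Gh.D) Gh.B
  C := Matrix.fromCols G.C (G.D * Gh.C)
  D := G.D * Gh.D

/-- The series realization of `Ĝ G` (the output of `G` is the input of `Ĝ`),
with state `(x, x̂)`. -/
def seriesRight {ι κ : Type*} [Fintype ι] [Fintype κ] (G : SISO ι) (Gh : SISO κ) :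
    SISO (ι ⊕ κ) where
  A := Matrix.fromBlocks G.A 0 (Gh.B * G.C) Gh.A
  B := Matrix.fromRows G.B (Gh.B * G.D)
  C := Matrix.fromCols (Gh.D * G.C) Gh.C
  D := Gh.D * G.D

end SISO

/-- The Kalman controllability matrix `(B, AB, …, Aⁿ⁻¹B)` of a single-input pair. -/
def kalman {n : ℕ} (A : Matrix (Fin n) (Fin n) ℝ) (B : Matrix (Fin n) (Fin 1) ℝ) :
    Matrix (Fin n) (Fin n) ℝ :=
  Matrix.of fun i j => (A ^ (j : ℕ) * B) i 0

/-- The Kalman observability matrix with rows `C, CA, …, CAⁿ⁻¹` of a single-output pair. -/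
def kalmanObs {n : ℕ} (A : Matrix (Fin n) (Fin n) ℝ) (C : Matrix (Fin 1) (Fin n) ℝ) :
    Matrix (Fin n) (Fin n) ℝ :=
  Matrix.of fun i j => (C * A ^ (i : ℕ)) 0 j

/-- Controllability of `(A, B)`. -/
def IsControllable {n : ℕ} (A : Matrix (Fin n) (Fin n) ℝ) (B : Matrix (Fin n) (Fin 1) ℝ) : Prop :=
  (kalman A B).rank = n

/-- Observability of `(A, C)`. -/
def IsObservable {n : ℕ} (A : Matrix (Fin n) (Fin n) ℝ) (C : Matrix (Fin 1) (Fin n) ℝ) : Prop :=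
  (kalmanObs A C).rank = n

/-- `z` is a complex eigenvalue of the real matrix `A`. -/
def IsEigenvalue {n : ℕ} (A : Matrix (Fin n) (Fin n) ℝ) (z : ℂ) : Prop :=
  Module.End.HasEigenvalue (Matrix.toLin' (A.map (algebraMap ℝ ℂ))) z

/-- `z` is a complex zero of the rational function `g`, i.e. of the numerator of `g` written in
lowest terms. -/
def IsZero (g : RatFunc ℝ) (z : ℂ) : Prop :=
  aeval z g.num = 0

end

section

open Matrix

namespace Matrix

/-! The solutions are transfer functions evaluated at the other system's state matrix: `L = Ĝ(A)`
and `M = G(Â)`. Hence `L` commutes with `A` and `M` with `Â`. Now `T` is the product of `(1 0; N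
1)`, `diag(L⁻¹, M)` and `(1 -K; 0 1)`. The Sylvester equation for `K` makes the right factor take
`𝒜₁` to `diag(A, Â)`, the middle factor commutes with `diag(A, Â)`, and the equation for `N` makes
the left factor take it to `𝒜₂`. Inputs and outputs match through four identities: `LB = BD̂ - KB̂`,
`MB̂ = B̂D - NB`, `CL = D̂C + ĈN`, `ĈM = DĈ + CK`. All four come from `exists_numerator`, applied to
each system on the left and on the right. Its core, `exists_compressed_quotient`, divides `p(z) -
p(A)` by `z - A` and evaluates the quotient, compressed by `C` and `B`, at a matrix tied to `A` by a
Sylvester equation. -/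

theorem mul_fin_one_eq_smul {κ : Type*} {R : Type*} [CommRing R]
    (H : Matrix κ (Fin 1) R) (c : Matrix (Fin 1) (Fin 1) R) : H * c = c 0 0 • H := by
  ext i j
  fin_cases j
  simp [Matrix.mul_apply, mul_comm (H i 0)]

theorem fin_one_mul_eq_smul {κ : Type*} {R : Type*} [CommRing R]
    (c : Matrix (Fin 1) (Fin 1) R) (H : Matrix (Fin 1) κ R) : c * H = c 0 0 • H := by
  ext i j
  fin_cases i
  simp [Matrix.mul_apply]

theorem map_aeval_C {ι K R : Type*} [Fintype ι] [DecidableEq ι] [CommRing K] [CommRing R]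
    (f : K →+* R) (c : K) (A : Matrix ι ι K) :
    (aeval A (Polynomial.C c)).map f = f c • (1 : Matrix ι ι R) := by
  ext i j
  by_cases h : i = j <;> simp [h, Matrix.algebraMap_matrix_apply]

end Matrix

namespace Polynomial

variable {K R : Type*} [CommRing K] [Ring R] [Algebra K R]

theorem aeval_C_eq_smul_one (x : R) (c : K) : aeval x (C c) = c • 1 := by
  rw [aeval_C, Algebra.algebraMap_eq_smul_one]

theorem aeval_mul_X_add_C (x : R) (q : K[X]) (c : K) :
    aeval x (q * X + C c) = aeval x q * x + c • 1 := by
  rw [map_add, map_mul, aeval_X, aeval_C_eq_smul_one]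

theorem commute_aeval_self (x : R) (q : K[X]) : Commute (aeval x q) x := by
  have := congrArg (aeval x) (mul_comm q X)
  rwa [map_mul, map_mul, aeval_X] at this

end Polynomial

/-! ### Transfer functions and their numerators -/

namespace SISO

variable {ι : Type*} [Fintype ι] [DecidableEq ι]

/-- The matrix `zI - A` over the field of rational functions. -/
noncomputable def pencil (A : Matrix ι ι ℝ) : Matrix ι ι (RatFunc ℝ) :=
  (RatFunc.X : RatFunc ℝ) • (1 : Matrix ι ι (RatFunc ℝ)) - A.map RatFunc.C

theorem det_pencil (A : Matrix ι ι ℝ) :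
    (pencil A).det = algebraMap ℝ[X] (RatFunc ℝ) A.charpoly := by
  rw [Matrix.charpoly, RingHom.map_det]
  congr 1
  ext i j
  by_cases h : i = j
  · subst h
    simp [pencil, RatFunc.algebraMap_X, RatFunc.algebraMap_C]
  · simp [pencil, RatFunc.algebraMap_C, h]

theorem isUnit_pencil (A : Matrix ι ι ℝ) : IsUnit (pencil A) := by
  rw [Matrix.isUnit_iff_isUnit_det, det_pencil, isUnit_iff_ne_zero]
  simpa using A.charpoly_monic.ne_zero

theorem transfer_eq (S : SISO ι) :
    S.transfer = (S.C.map RatFunc.C * (pencil S.A)⁻¹ * S.B.map RatFunc.C) 0 0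
      + RatFunc.C (S.D 0 0) := rfl

/-- The quotient of `p(z) - p(A)` by `z - A`, compressed to a polynomial by `C` and `B`. -/
theorem exists_compressed_quotient (S : SISO ι) (d : ℕ) : ∀ p : ℝ[X], p.natDegree ≤ d →
    ∃ γ : ℝ[X], γ.natDegree ≤ d ∧
      algebraMap ℝ[X] (RatFunc ℝ) γ = (S.C.map RatFunc.C * (pencil S.A)⁻¹ *
        (algebraMap ℝ[X] (RatFunc ℝ) p • (1 : Matrix ι ι (RatFunc ℝ)) -
          (aeval S.A p).map RatFunc.C) * S.B.map RatFunc.C) 0 0 ∧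
      (∀ {κ : Type} [Fintype κ] [DecidableEq κ] (F : Matrix κ κ ℝ) (N : Matrix κ ι ℝ)
        (H : Matrix κ (Fin 1) ℝ), F * N - N * S.A + H * S.C = 0 →
        (aeval F p * N - N * aeval S.A p) * S.B = -(aeval F γ * H)) ∧
      (∀ {κ : Type} [Fintype κ] [DecidableEq κ] (F : Matrix κ κ ℝ) (K : Matrix ι κ ℝ)
        (H : Matrix (Fin 1) κ ℝ), S.A * K - K * F + S.B * H = 0 →
        S.C * (aeval S.A p * K - K * aeval F p) = -(H * aeval F γ)) := by
  induction d with
  | zero =>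
    intro p hp
    obtain ⟨c, rfl⟩ : ∃ c, p = Polynomial.C c := ⟨_, eq_C_of_natDegree_le_zero hp⟩
    refine ⟨0, by simp, ?_, ?_, ?_⟩
    · rw [Matrix.map_aeval_C, RatFunc.algebraMap_C]
      simp
    · intro κ _ _ F N H _
      simp [aeval_C_eq_smul_one, -aeval_C]
    · intro κ _ _ F N H _
      simp [aeval_C_eq_smul_one, -aeval_C]
  | succ d ih =>
    -- Horner's scheme: if `p = qX + c`, the compressed quotients satisfy `γ_p = γ_q X + C q(A) B`.
    intro p hp
    obtain ⟨γ, hγ, hz, hl, hr⟩ := ih p.divX (by rw [natDegree_divX_eq_natDegree_tsub_one]; omega)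
    set q := p.divX with hq
    obtain ⟨c, hp'⟩ : ∃ c, p = q * Polynomial.X + Polynomial.C c := ⟨_, (divX_mul_X_add p).symm⟩
    set s : ℝ := (S.C * aeval S.A q * S.B) 0 0 with hs
    have hsA : S.C * aeval S.A q * S.B = s • 1 := by
      ext i j; fin_cases i; fin_cases j; simp [hs]
    refine ⟨γ * Polynomial.X + Polynomial.C s, ?_, ?_, ?_, ?_⟩
    · refine (natDegree_add_le _ _).trans (max_le ?_ (by simp))
      exact natDegree_mul_le.trans (by simpa using hγ)
    · have e1 : algebraMap ℝ[X] (RatFunc ℝ) p • (1 : Matrix ι ι (RatFunc ℝ)) -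
          (aeval S.A p).map RatFunc.C =
          (RatFunc.X : RatFunc ℝ) • (algebraMap ℝ[X] (RatFunc ℝ) q • (1 : Matrix ι ι (RatFunc ℝ)) -
            (aeval S.A q).map RatFunc.C) + pencil S.A * (aeval S.A q).map RatFunc.C := by
        have : (aeval S.A p).map RatFunc.C = S.A.map RatFunc.C * (aeval S.A q).map RatFunc.C
            + RatFunc.C c • (1 : Matrix ι ι (RatFunc ℝ)) := by
          rw [← Matrix.map_aeval_C RatFunc.C c S.A, ← Matrix.map_mul,
            ← Matrix.map_add _ (map_add _), ← (commute_aeval_self S.A q).eq, hp',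
            aeval_mul_X_add_C, aeval_C_eq_smul_one]
        rw [this, hp', pencil]
        simp only [map_add, map_mul, RatFunc.algebraMap_X, RatFunc.algebraMap_C, sub_mul,
          smul_mul_assoc, one_mul, smul_sub, smul_smul, add_smul]
        rw [mul_comm]
        abel
      have e2 : RatFunc.C s = (S.C.map RatFunc.C * (aeval S.A q).map RatFunc.C *
          S.B.map RatFunc.C) 0 0 := by
        rw [← Matrix.map_mul, ← Matrix.map_mul]; rfl
      have e3 : (pencil S.A)⁻¹ * pencil S.A = 1 :=
        Matrix.nonsing_inv_mul _ ((Matrix.isUnit_iff_isUnit_det _).1 (isUnit_pencil _))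
      have e4 (Y Z : Matrix ι ι (RatFunc ℝ)) : S.C.map RatFunc.C * (pencil S.A)⁻¹ *
          ((RatFunc.X : RatFunc ℝ) • Y + pencil S.A * Z) * S.B.map RatFunc.C =
          (RatFunc.X : RatFunc ℝ) • (S.C.map RatFunc.C * (pencil S.A)⁻¹ * Y * S.B.map RatFunc.C)
            + S.C.map RatFunc.C * Z * S.B.map RatFunc.C := by
        rw [Matrix.mul_add, Matrix.add_mul, Matrix.mul_smul, Matrix.smul_mul,
          Matrix.mul_assoc _ _ (pencil S.A * _), ← Matrix.mul_assoc _ (pencil S.A), e3,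
          Matrix.one_mul]
      rw [e1, e4, Matrix.add_apply, Matrix.smul_apply, smul_eq_mul, ← hz, ← e2, map_add, map_mul,
        RatFunc.algebraMap_X, RatFunc.algebraMap_C, mul_comm]
    · intro κ _ _ F N H h
      have e := hl F N H h
      have h' : F * N - N * S.A = -(H * S.C) := eq_neg_of_add_eq_zero_left h
      -- Telescoping isolates one factor `FN - NA = -HC`; multiplied by `q(A)B` it becomes `-sH`,
      -- the new constant term of `γ`.
      have : aeval F p * N - N * aeval S.A p =
          F * (aeval F q * N - N * aeval S.A q) + (F * N - N * S.A) * aeval S.A q := by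
        rw [hp', aeval_mul_X_add_C, aeval_mul_X_add_C, (commute_aeval_self F q).eq,
          (commute_aeval_self S.A q).eq]
        simp only [Matrix.mul_sub, Matrix.sub_mul, Matrix.add_mul, Matrix.mul_add,
          Matrix.mul_assoc, Matrix.smul_mul, Matrix.mul_smul, Matrix.one_mul, Matrix.mul_one]
        abel
      rw [this, h', Matrix.add_mul, Matrix.mul_assoc F, e]
      have h2 : -(H * S.C) * aeval S.A q * S.B = -(s • H) := by
        rw [Matrix.neg_mul, Matrix.neg_mul, Matrix.mul_assoc, Matrix.mul_assoc,
          ← Matrix.mul_assoc S.C, hsA]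
        simp
      rw [h2]
      have : aeval F (γ * Polynomial.X + Polynomial.C s) = F * aeval F γ + s • 1 := by
        rw [aeval_mul_X_add_C, (commute_aeval_self F γ).eq]
      rw [this, Matrix.add_mul, Matrix.mul_assoc]
      simp [add_comm]
    · intro κ _ _ F K H h
      have e := hr F K H h
      have h' : S.A * K - K * F = -(S.B * H) := eq_neg_of_add_eq_zero_left h
      have : aeval S.A p * K - K * aeval F p =
          (aeval S.A q * K - K * aeval F q) * F + aeval S.A q * (S.A * K - K * F) := by
        rw [hp', aeval_mul_X_add_C, aeval_mul_X_add_C]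
        simp only [Matrix.mul_sub, Matrix.sub_mul, Matrix.add_mul, Matrix.mul_add,
          Matrix.mul_assoc, Matrix.smul_mul, Matrix.mul_smul, Matrix.one_mul, Matrix.mul_one]
        abel
      rw [this, h', Matrix.mul_add, ← Matrix.mul_assoc, e]
      have h2 : S.C * (aeval S.A q * -(S.B * H)) = -(s • H) := by
        rw [Matrix.mul_neg, Matrix.mul_neg, ← Matrix.mul_assoc, ← Matrix.mul_assoc, hsA]
        simp
      rw [h2]
      have : aeval F (γ * Polynomial.X + Polynomial.C s) = aeval F γ * F + s • 1 :=
        aeval_mul_X_add_C _ _ _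
      rw [this, Matrix.mul_add, ← Matrix.mul_assoc]
      simp [add_comm]

/-- The numerator `β = G α` of the transfer function over the characteristic polynomial, together
with the identities it satisfies at matrices related to `S.A` by a Sylvester equation. -/
theorem exists_numerator (S : SISO ι) : ∃ β : ℝ[X],
    algebraMap ℝ[X] (RatFunc ℝ) β = S.transfer * algebraMap ℝ[X] (RatFunc ℝ) S.A.charpoly ∧
    β.natDegree ≤ Fintype.card ι ∧
    (∀ {κ : Type} [Fintype κ] [DecidableEq κ] (F : Matrix κ κ ℝ) (N : Matrix κ ι ℝ)
      (H : Matrix κ (Fin 1) ℝ), F * N - N * S.A + H * S.C = 0 →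
      aeval F β * H = aeval F S.A.charpoly * (H * S.D - N * S.B)) ∧
    (∀ {κ : Type} [Fintype κ] [DecidableEq κ] (F : Matrix κ κ ℝ) (K : Matrix ι κ ℝ)
      (H : Matrix (Fin 1) κ ℝ), S.A * K - K * F + S.B * H = 0 →
      H * aeval F β = (S.D * H + S.C * K) * aeval F S.A.charpoly) := by
  have hdeg : S.A.charpoly.natDegree = Fintype.card ι := S.A.charpoly_natDegree_eq_dim
  obtain ⟨γ, hγ, hz, hl, hr⟩ := S.exists_compressed_quotient _ S.A.charpoly hdeg.le
  -- For `p = α`, Cayley–Hamilton removes `p(A)`, which leaves `γ = α · C(z - A)⁻¹B`; adding `αD`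
  -- gives `β`.
  rw [Matrix.aeval_self_charpoly, Matrix.map_zero _ (map_zero _), sub_zero, Matrix.mul_smul,
    Matrix.mul_one, Matrix.smul_mul, Matrix.smul_apply, smul_eq_mul] at hz
  simp only [Matrix.aeval_self_charpoly, Matrix.mul_zero, Matrix.zero_mul, sub_zero,
    zero_sub] at hl hr
  have hβ {κ : Type} [Fintype κ] [DecidableEq κ] (F : Matrix κ κ ℝ) :
      aeval F (γ + S.A.charpoly * Polynomial.C (S.D 0 0)) =
        aeval F γ + S.D 0 0 • aeval F S.A.charpoly := by
    simp [Algebra.algebraMap_eq_smul_one]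
  refine ⟨γ + S.A.charpoly * Polynomial.C (S.D 0 0), ?_, ?_, ?_, ?_⟩
  · rw [map_add, map_mul, RatFunc.algebraMap_C, hz, transfer_eq, add_mul]
    ring
  · refine (natDegree_add_le _ _).trans (max_le hγ ?_)
    exact natDegree_mul_le.trans (by simp [hdeg])
  · intro κ _ _ F N H h
    have e := hl F N H h
    rw [hβ, Matrix.mul_sub, Matrix.add_mul, ← Matrix.mul_assoc _ N, e,
      Matrix.mul_fin_one_eq_smul H]
    simp [add_comm]
  · intro κ _ _ F K H h
    have e := hr F K H h
    rw [Matrix.mul_neg, neg_inj] at e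
    rw [hβ, Matrix.mul_add, Matrix.add_mul, Matrix.mul_assoc _ K, e,
      Matrix.fin_one_mul_eq_smul S.D]
    simp [add_comm]

/-! ### Series connections realize the products -/

theorem transfer_seriesLeft {κ : Type*} [Fintype κ] [DecidableEq κ] (G : SISO ι) (Gh : SISO κ) :
    (G.seriesLeft Gh).transfer = G.transfer * Gh.transfer := by
  have hp : pencil (G.seriesLeft Gh).A = Matrix.fromBlocks (pencil G.A)
      (-(G.B.map RatFunc.C * Gh.C.map RatFunc.C)) 0 (pencil Gh.A) := by
    ext (i | i) (j | j) <;> simp [pencil, seriesLeft, Matrix.mul_apply, Matrix.one_apply]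
  have hB : (G.seriesLeft Gh).B.map RatFunc.C = Matrix.fromRows
      (G.B.map RatFunc.C * Gh.D.map RatFunc.C) (Gh.B.map RatFunc.C) := by
    ext (i | i) j <;> simp [seriesLeft, Matrix.mul_apply]
  have hC : (G.seriesLeft Gh).C.map RatFunc.C = Matrix.fromCols
      (G.C.map RatFunc.C) (G.D.map RatFunc.C * Gh.C.map RatFunc.C) := by
    ext i (j | j) <;> simp [seriesLeft, Matrix.mul_apply]
  have hD : (G.seriesLeft Gh).D.map RatFunc.C = G.D.map RatFunc.C * Gh.D.map RatFunc.C := by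
    rw [← Matrix.map_mul]; rfl
  have hm : G.transfer * Gh.transfer =
      ((G.C.map RatFunc.C * (pencil G.A)⁻¹ * G.B.map RatFunc.C + G.D.map RatFunc.C) *
      (Gh.C.map RatFunc.C * (pencil Gh.A)⁻¹ * Gh.B.map RatFunc.C + Gh.D.map RatFunc.C)) 0 0 := by
    simp [Matrix.mul_apply (M := _ + _), transfer, pencil]
  rw [hm]
  change ((G.seriesLeft Gh).C.map RatFunc.C * (pencil (G.seriesLeft Gh).A)⁻¹ *
    (G.seriesLeft Gh).B.map RatFunc.C + (G.seriesLeft Gh).D.map RatFunc.C) 0 0 = _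
  rw [hp, hB, hC, hD, Matrix.inv_fromBlocks_zero₂₁_of_isUnit_iff _ _ _
    (iff_of_true (isUnit_pencil _) (isUnit_pencil _))]
  simp only [Matrix.fromCols_mul_fromBlocks, Matrix.fromCols_mul_fromRows, Matrix.mul_neg,
    Matrix.neg_mul, neg_neg, Matrix.mul_add, Matrix.add_mul, Matrix.mul_assoc, Matrix.mul_zero,
    add_zero]
  simp only [add_assoc, add_left_comm]

theorem transfer_seriesRight {κ : Type*} [Fintype κ] [DecidableEq κ] (G : SISO ι) (Gh : SISO κ) :
    (G.seriesRight Gh).transfer = Gh.transfer * G.transfer := by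
  have hp : pencil (G.seriesRight Gh).A = Matrix.fromBlocks (pencil G.A) 0
      (-(Gh.B.map RatFunc.C * G.C.map RatFunc.C)) (pencil Gh.A) := by
    ext (i | i) (j | j) <;> simp [pencil, seriesRight, Matrix.mul_apply, Matrix.one_apply]
  have hB : (G.seriesRight Gh).B.map RatFunc.C = Matrix.fromRows
      (G.B.map RatFunc.C) (Gh.B.map RatFunc.C * G.D.map RatFunc.C) := by
    ext (i | i) j <;> simp [seriesRight, Matrix.mul_apply]
  have hC : (G.seriesRight Gh).C.map RatFunc.C = Matrix.fromCols
      (Gh.D.map RatFunc.C * G.C.map RatFunc.C) (Gh.C.map RatFunc.C) := by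
    ext i (j | j) <;> simp [seriesRight, Matrix.mul_apply]
  have hD : (G.seriesRight Gh).D.map RatFunc.C = Gh.D.map RatFunc.C * G.D.map RatFunc.C := by
    rw [← Matrix.map_mul]; rfl
  have hm : Gh.transfer * G.transfer =
      ((Gh.C.map RatFunc.C * (pencil Gh.A)⁻¹ * Gh.B.map RatFunc.C + Gh.D.map RatFunc.C) *
      (G.C.map RatFunc.C * (pencil G.A)⁻¹ * G.B.map RatFunc.C + G.D.map RatFunc.C)) 0 0 := by
    simp [Matrix.mul_apply (M := _ + _), transfer, pencil]
  rw [hm]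
  change ((G.seriesRight Gh).C.map RatFunc.C * (pencil (G.seriesRight Gh).A)⁻¹ *
    (G.seriesRight Gh).B.map RatFunc.C + (G.seriesRight Gh).D.map RatFunc.C) 0 0 = _
  rw [hp, hB, hC, hD, Matrix.inv_fromBlocks_zero₁₂_of_isUnit_iff _ _ _
    (iff_of_true (isUnit_pencil _) (isUnit_pencil _))]
  simp only [Matrix.fromCols_mul_fromBlocks, Matrix.fromCols_mul_fromRows, Matrix.mul_neg,
    Matrix.neg_mul, neg_neg, Matrix.mul_add, Matrix.add_mul, Matrix.mul_assoc, Matrix.mul_zero,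
    zero_add]
  simp only [add_assoc, add_left_comm]

end SISO

/-! ### Polynomials in matrices and Sylvester equations -/

namespace Matrix

/-- In a Bézout identity evaluated at `A`, Cayley–Hamilton kills the characteristic polynomial and
leaves an inverse of `p(A)`. -/
theorem isUnit_aeval_of_isCoprime_charpoly {ι K : Type*} [Fintype ι] [DecidableEq ι] [Field K]
    (A : Matrix ι ι K) {p : K[X]} (h : IsCoprime p A.charpoly) : IsUnit (aeval A p) := by
  obtain ⟨a, b, hab⟩ := h
  have := congrArg (aeval A) hab
  rw [map_add, map_mul, map_mul, aeval_self_charpoly, mul_zero, add_zero, map_one] at this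
  exact (Matrix.isUnit_iff_isUnit_det _).2 (isUnit_det_of_left_inverse this)

theorem aeval_mul_of_mul_eq {ι κ K : Type*} [Fintype ι] [DecidableEq ι] [Fintype κ]
    [DecidableEq κ] [CommRing K] {A : Matrix ι ι K} {F : Matrix κ κ K} {X : Matrix ι κ K}
    (h : A * X = X * F) (p : K[X]) : aeval A p * X = X * aeval F p := by
  induction p using Polynomial.induction_on' with
  | add p q hp hq => simp only [map_add, Matrix.add_mul, Matrix.mul_add, hp, hq]
  | monomial k c =>
    have hk : A ^ k * X = X * F ^ k := by
      induction k with
      | zero => simp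
      | succ k ih => rw [pow_succ, Matrix.mul_assoc, h, ← Matrix.mul_assoc, ih, Matrix.mul_assoc,
          pow_succ]
    rw [aeval_monomial, aeval_monomial, Algebra.algebraMap_eq_smul_one,
      Algebra.algebraMap_eq_smul_one]
    simp [hk]

/-- The Sylvester equation `A X - X F + Q = 0` is uniquely solvable when the characteristic
polynomials of `A` and `F` are coprime. -/
theorem existsUnique_sylvester {ι κ K : Type*} [Fintype ι] [DecidableEq ι] [Fintype κ]
    [DecidableEq κ] [Field K] (A : Matrix ι ι K) (F : Matrix κ κ K)
    (h : IsCoprime A.charpoly F.charpoly) (Q : Matrix ι κ K) :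
    ∃! X : Matrix ι κ K, A * X - X * F + Q = 0 := by
  let f : Matrix ι κ K →ₗ[K] Matrix ι κ K :=
    { toFun := fun X => A * X - X * F
      map_add' := fun X Y => by rw [Matrix.mul_add, Matrix.add_mul]; abel
      map_smul' := fun c X => by simp [smul_sub] }
  have hinj : Function.Injective f := by
    rw [← LinearMap.ker_eq_bot, LinearMap.ker_eq_bot']
    intro X hX
    -- A homogeneous solution satisfies `χ_F(A) X = X χ_F(F) = 0`, and `χ_F(A)` is invertible.
    have e := aeval_mul_of_mul_eq (sub_eq_zero.1 hX : A * X = X * F) F.charpoly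
    rw [aeval_self_charpoly, Matrix.mul_zero] at e
    have hu := (Matrix.isUnit_iff_isUnit_det _).1 (A.isUnit_aeval_of_isCoprime_charpoly h.symm)
    rw [← nonsing_inv_mul_cancel_left _ X hu, e, Matrix.mul_zero]
  obtain ⟨X, hX⟩ := LinearMap.injective_iff_surjective.1 hinj (-Q)
  refine ⟨X, eq_neg_iff_add_eq_zero.1 hX, fun Y hY => hinj ?_⟩
  rw [hX]
  exact eq_neg_iff_add_eq_zero.2 hY

theorem commute_inv_left {ι K : Type*} [Fintype ι] [DecidableEq ι] [CommRing K]
    {A B : Matrix ι ι K} (hA : IsUnit A) (h : Commute A B) : Commute A⁻¹ B := by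
  obtain ⟨u, rfl⟩ := hA
  rw [← coe_units_inv]
  exact h.units_inv_left

theorem isUnit_of_rank_eq {n : ℕ} {K : Type*} [Field K] {A : Matrix (Fin n) (Fin n) K}
    (h : A.rank = n) : IsUnit A := by
  have hcard : A.rank = Fintype.card (Fin n) := by simpa using h
  rw [← Matrix.mulVec_surjective_iff_isUnit, ← Matrix.coe_mulVecLin, ← LinearMap.range_eq_top]
  exact Submodule.eq_top_of_finrank_eq (by simpa [Matrix.rank] using hcard)

end Matrix

theorem isEigenvalue_iff {n : ℕ} (A : Matrix (Fin n) (Fin n) ℝ) (z : ℂ) :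
    IsEigenvalue A z ↔ aeval z A.charpoly = 0 := by
  rw [IsEigenvalue, Module.End.hasEigenvalue_iff_isRoot_charpoly, Matrix.charpoly_toLin',
    Matrix.charpoly_map, IsRoot, eval_map_algebraMap]

theorem Polynomial.isCoprime_of_no_common_zero {p q : ℝ[X]}
    (h : ∀ z : ℂ, ¬ (aeval z p = 0 ∧ aeval z q = 0)) : IsCoprime p q :=
  (isCoprime_iff_aeval_ne_zero_of_isAlgClosed ℝ ℂ p q).2 fun z => by
    have := h z
    tauto

/-- For `L` commuting with `A`, this reduces equation 2 to the single column identity `LB = BD̂ -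
KB̂`. -/
theorem kalman_mul {n : ℕ} {A L : Matrix (Fin n) (Fin n) ℝ} (h : Commute L A)
    (B : Matrix (Fin n) (Fin 1) ℝ) : L * kalman A B = kalman A (L * B) := by
  ext i j
  change _ = (A ^ (j : ℕ) * (L * B)) i 0
  rw [← Matrix.mul_assoc, ← (h.pow_right _).eq, Matrix.mul_assoc, Matrix.mul_apply,
    Matrix.mul_apply]
  rfl

/-! ### The state-coordinate change -/

theorem SISO.transformsTo_series {ι κ : Type*} [Fintype ι] [DecidableEq ι] [Fintype κ]
    [DecidableEq κ] (G : SISO ι) (Gh : SISO κ) {K : Matrix ι κ ℝ} {L : Matrix ι ι ℝ}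
    {M : Matrix κ κ ℝ} {N : Matrix κ ι ℝ}
    (hK : G.A * K - K * Gh.A + G.B * Gh.C = 0) (hN : Gh.A * N - N * G.A + Gh.B * G.C = 0)
    (hL : IsUnit L) (hM : IsUnit M) (hLA : Commute L G.A) (hMA : Commute M Gh.A)
    (hLB : L * G.B = G.B * Gh.D - K * Gh.B) (hMB : M * Gh.B = Gh.B * G.D - N * G.B)
    (hCL : G.C * L = Gh.D * G.C + Gh.C * N) (hCM : Gh.C * M = G.D * Gh.C + G.C * K) :
    (G.seriesLeft Gh).TransformsTo
      (Matrix.fromBlocks L⁻¹ (-(L⁻¹ * K)) (N * L⁻¹) (M - N * L⁻¹ * K))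
      (G.seriesRight Gh) := by
  have hLd := (Matrix.isUnit_iff_isUnit_det _).1 hL
  have hMd := (Matrix.isUnit_iff_isUnit_det _).1 hM
  have hLA' : L⁻¹ * G.A = G.A * L⁻¹ := (Matrix.commute_inv_left hL hLA).eq
  have hK' : G.B * Gh.C = K * Gh.A - G.A * K := by
    rw [← sub_eq_zero, ← hK]; abel
  have hN' : Gh.B * G.C = N * G.A - Gh.A * N := by
    rw [← sub_eq_zero, ← hN]; abel
  have hB' : L⁻¹ * (G.B * Gh.D) = G.B + L⁻¹ * (K * Gh.B) := by
    rw [← sub_eq_iff_eq_add, ← Matrix.mul_sub, ← hLB, Matrix.nonsing_inv_mul_cancel_left _ _ hLd]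
  have hB2 : Gh.B * G.D = M * Gh.B + N * G.B := by rw [hMB]; abel
  have hC' : Gh.D * (G.C * L⁻¹) + Gh.C * (N * L⁻¹) = G.C := by
    rw [← Matrix.mul_assoc, ← Matrix.mul_assoc, ← Matrix.add_mul, ← hCL,
      Matrix.mul_nonsing_inv_cancel_right _ _ hLd]
  have hC2 : Gh.D * (G.C * (L⁻¹ * K)) + Gh.C * (N * (L⁻¹ * K)) = G.C * K := by
    simpa only [Matrix.add_mul, Matrix.mul_assoc] using congrArg (· * K) hC'
  set T := Matrix.fromBlocks L⁻¹ (-(L⁻¹ * K)) (N * L⁻¹) (M - N * L⁻¹ * K) with hT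
  have hTu : IsUnit T := by
    have : T = Matrix.fromBlocks 1 0 N 1 * Matrix.fromBlocks L⁻¹ 0 0 M *
        Matrix.fromBlocks 1 (-K) 0 1 := by
      simp only [hT, Matrix.fromBlocks_multiply, Matrix.one_mul, Matrix.mul_one, Matrix.zero_mul,
        Matrix.mul_zero, add_zero, zero_add, Matrix.mul_neg, Matrix.mul_assoc]
      congr 1; abel
    rw [this, Matrix.isUnit_iff_isUnit_det]
    simp only [Matrix.det_mul, Matrix.det_fromBlocks_zero₁₂, Matrix.det_fromBlocks_zero₂₁,
      Matrix.det_one, one_mul, mul_one]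
    exact (Matrix.isUnit_nonsing_inv_det _ hLd).mul hMd
  have hTd := (Matrix.isUnit_iff_isUnit_det _).1 hTu
  refine ⟨hTu, ?_, ?_, ?_, ?_⟩
  -- Intertwining relations avoid computing `T⁻¹`.
  · have : (G.seriesRight Gh).A * T = T * (G.seriesLeft Gh).A := by
      simp only [hT, seriesLeft, seriesRight, Matrix.fromBlocks_multiply, hK', hN']
      have e (Y : Matrix ι κ ℝ) : L⁻¹ * (G.A * Y) = G.A * (L⁻¹ * Y) := by
        rw [← Matrix.mul_assoc, hLA', Matrix.mul_assoc]
      congr 1 <;>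
      simp only [Matrix.mul_sub, Matrix.sub_mul, Matrix.mul_neg, Matrix.neg_mul, Matrix.mul_zero,
        Matrix.zero_mul, add_zero, Matrix.mul_assoc, e, hLA', hMA.eq] <;> abel
    rw [← this, Matrix.mul_nonsing_inv_cancel_right _ _ hTd]
  · simp only [hT, seriesLeft, seriesRight, Matrix.fromBlocks_mul_fromRows]
    rw [hB2]
    congr 1 <;>
    simp only [Matrix.mul_assoc, Matrix.sub_mul, Matrix.neg_mul, hB', Matrix.mul_add] <;> abel
  · have : (G.seriesRight Gh).C * T = (G.seriesLeft Gh).C := by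
      simp only [hT, seriesLeft, seriesRight, Matrix.fromCols_mul_fromBlocks]
      congr 1
      · rw [Matrix.mul_assoc, hC']
      · rw [Matrix.mul_sub, hCM, Matrix.mul_neg, Matrix.mul_assoc, Matrix.mul_assoc, ← hC2]
        abel
    rw [← this, Matrix.mul_nonsing_inv_cancel_right _ _ hTd]
  · ext i j
    fin_cases i; fin_cases j
    simp [seriesLeft, seriesRight, Matrix.mul_apply, mul_comm]

end

theorem lemma5 {n m : ℕ} (G : SISO (Fin n)) (Gh : SISO (Fin m))
    (hctrb : IsControllable G.A G.B) (hobs : IsObservable G.A G.C)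
    (heig : ∀ z : ℂ, ¬ (IsEigenvalue G.A z ∧ IsEigenvalue Gh.A z)) :
    -- `β := G α` is a polynomial of degree at most `n`
    ∃ β : ℝ[X],
      algebraMap ℝ[X] (RatFunc ℝ) β = G.transfer * algebraMap ℝ[X] (RatFunc ℝ) G.A.charpoly ∧
      β.natDegree ≤ n ∧
      -- if `(β, α̂)` and `(α, Ĝ)` have no common zeros
      ((∀ z : ℂ, ¬ (aeval z β = 0 ∧ aeval z Gh.A.charpoly = 0)) →
        (∀ z : ℂ, ¬ (aeval z G.A.charpoly = 0 ∧ IsZero Gh.transfer z)) →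
        -- the two series interconnections realize the two products
        (G.seriesLeft Gh).transfer = G.transfer * Gh.transfer ∧
        (G.seriesRight Gh).transfer = Gh.transfer * G.transfer ∧
        -- the four matrix equations are uniquely solvable
        (∃! K : Matrix (Fin n) (Fin m) ℝ, G.A * K - K * Gh.A + G.B * Gh.C = 0) ∧
        (∀ K : Matrix (Fin n) (Fin m) ℝ, G.A * K - K * Gh.A + G.B * Gh.C = 0 →
          ∃! L : Matrix (Fin n) (Fin n) ℝ,
            L * kalman G.A G.B = kalman G.A (G.B * Gh.D - K * Gh.B)) ∧
        (∃! M : Matrix (Fin m) (Fin m) ℝ, M * aeval Gh.A G.A.charpoly = aeval Gh.A β) ∧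
        (∃! N : Matrix (Fin m) (Fin n) ℝ, Gh.A * N - N * G.A + Gh.B * G.C = 0) ∧
        -- their solutions define the state-coordinate change
        ∀ (K : Matrix (Fin n) (Fin m) ℝ) (L : Matrix (Fin n) (Fin n) ℝ)
          (M : Matrix (Fin m) (Fin m) ℝ) (N : Matrix (Fin m) (Fin n) ℝ),
          G.A * K - K * Gh.A + G.B * Gh.C = 0 →
          L * kalman G.A G.B = kalman G.A (G.B * Gh.D - K * Gh.B) →
          M * aeval Gh.A G.A.charpoly = aeval Gh.A β →
          Gh.A * N - N * G.A + Gh.B * G.C = 0 →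
          IsUnit L ∧
          (G.seriesLeft Gh).TransformsTo
            (Matrix.fromBlocks L⁻¹ (-(L⁻¹ * K)) (N * L⁻¹) (M - N * L⁻¹ * K))
            (G.seriesRight Gh)) := by
  obtain ⟨β, hβ, hdeg, hβl, hβr⟩ := G.exists_numerator
  obtain ⟨βh, hβh, -, hβhl, hβhr⟩ := Gh.exists_numerator
  refine ⟨β, hβ, by simpa using hdeg, fun hz₁ hz₂ => ?_⟩
  have hcop : IsCoprime G.A.charpoly Gh.A.charpoly :=
    isCoprime_of_no_common_zero fun z => by
      rw [← isEigenvalue_iff, ← isEigenvalue_iff]; exact heig z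
  have hcopβh : IsCoprime βh G.A.charpoly := by
    refine isCoprime_of_no_common_zero fun z ⟨h₁, h₂⟩ => hz₂ z ⟨h₂, ?_⟩
    -- `IsZero` concerns the reduced numerator, while `βh` may share factors with `α̂`.
    -- Cross-multiplying shows that a root of `βh` is a zero of `Ĝ` or a root of `α̂`; the latter is
    -- excluded at roots of `α`.
    have hmul : βh * Gh.transfer.denom = Gh.transfer.num * Gh.A.charpoly := by
      apply RatFunc.algebraMap_injective ℝ
      have hd := RatFunc.algebraMap_ne_zero Gh.transfer.denom_ne_zero
      rw [map_mul, map_mul, hβh]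
      nth_rewrite 1 [← RatFunc.num_div_denom Gh.transfer]
      field_simp
    have hev := congrArg (aeval z) hmul
    rw [map_mul, map_mul, h₁, zero_mul] at hev
    refine (mul_eq_zero.1 hev.symm).resolve_right fun h => heig z ?_
    exact ⟨(isEigenvalue_iff _ _).2 h₂, (isEigenvalue_iff _ _).2 h⟩
  have hu : IsUnit (aeval Gh.A G.A.charpoly) :=
    Gh.A.isUnit_aeval_of_isCoprime_charpoly hcop
  have huh : IsUnit (aeval G.A Gh.A.charpoly) :=
    G.A.isUnit_aeval_of_isCoprime_charpoly hcop.symm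
  have huβ : IsUnit (aeval Gh.A β) :=
    Gh.A.isUnit_aeval_of_isCoprime_charpoly (isCoprime_of_no_common_zero hz₁)
  have huβh : IsUnit (aeval G.A βh) := G.A.isUnit_aeval_of_isCoprime_charpoly hcopβh
  have hkal : IsUnit (kalman G.A G.B) := Matrix.isUnit_of_rank_eq hctrb
  have hkd := (Matrix.isUnit_iff_isUnit_det _).1 hkal
  have hud := (Matrix.isUnit_iff_isUnit_det _).1 hu
  have huhd := (Matrix.isUnit_iff_isUnit_det _).1 huh
  have comm {k : ℕ} (F : Matrix (Fin k) (Fin k) ℝ) (p q : ℝ[X]) :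
      Commute (aeval F p) (aeval F q) := by
    rw [Commute, SemiconjBy, ← map_mul, ← map_mul, mul_comm]
  -- This is `Ĝ(A)`, free of `K`. Both orders of the factors are needed: inverse on the left for
  -- `LB`, on the right for `CL`.
  set L₀ : Matrix (Fin n) (Fin n) ℝ := (aeval G.A Gh.A.charpoly)⁻¹ * aeval G.A βh with hL₀
  have hL₀u : IsUnit L₀ := ((Matrix.isUnit_nonsing_inv_iff).2 huh).mul huβh
  have hL₀A : Commute L₀ G.A := (Matrix.commute_inv_left huh (commute_aeval_self _ _)).mul_left (commute_aeval_self _ _)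
  have hL₀r : L₀ = aeval G.A βh * (aeval G.A Gh.A.charpoly)⁻¹ := (Matrix.commute_inv_left huh (comm _ _ _)).eq
  have hL₀B (K : Matrix (Fin n) (Fin m) ℝ) (hK : G.A * K - K * Gh.A + G.B * Gh.C = 0) :
      L₀ * G.B = G.B * Gh.D - K * Gh.B := by
    rw [hL₀, Matrix.mul_assoc, hβhl G.A K G.B hK, Matrix.nonsing_inv_mul_cancel_left _ _ huhd]
  have hL₀K (K : Matrix (Fin n) (Fin m) ℝ) (hK : G.A * K - K * Gh.A + G.B * Gh.C = 0) :
      L₀ * kalman G.A G.B = kalman G.A (G.B * Gh.D - K * Gh.B) := by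
    rw [kalman_mul hL₀A, hL₀B K hK]
  set M₀ : Matrix (Fin m) (Fin m) ℝ := aeval Gh.A β * (aeval Gh.A G.A.charpoly)⁻¹ with hM₀
  have hM₀e : M₀ * aeval Gh.A G.A.charpoly = aeval Gh.A β :=
    Matrix.nonsing_inv_mul_cancel_right _ _ hud
  have hM₀l : M₀ = (aeval Gh.A G.A.charpoly)⁻¹ * aeval Gh.A β := (Matrix.commute_inv_left hu (comm _ _ _)).eq.symm
  refine ⟨G.transfer_seriesLeft Gh, G.transfer_seriesRight Gh,
    Matrix.existsUnique_sylvester _ _ hcop _,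
    fun K hK => ⟨L₀, hL₀K K hK, fun L hL => hkal.mul_right_cancel (hL.trans (hL₀K K hK).symm)⟩,
    ⟨M₀, hM₀e, fun M hM => hu.mul_right_cancel (hM.trans hM₀e.symm)⟩,
    Matrix.existsUnique_sylvester _ _ hcop.symm _, fun K L M N hK hL hM hN => ?_⟩
  obtain rfl : L = L₀ := hkal.mul_right_cancel (hL.trans (hL₀K K hK).symm)
  obtain rfl : M = M₀ := hu.mul_right_cancel (hM.trans hM₀e.symm)
  refine ⟨hL₀u, G.transformsTo_series Gh hK hN hL₀u
    (huβ.mul ((Matrix.isUnit_nonsing_inv_iff).2 hu)) hL₀A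
    ((commute_aeval_self _ _).mul_left (Matrix.commute_inv_left hu (commute_aeval_self _ _))) (hL₀B K hK) ?_ ?_ ?_⟩
  · rw [hM₀l, Matrix.mul_assoc, hβl Gh.A N Gh.B hN, Matrix.nonsing_inv_mul_cancel_left _ _ hud]
  · rw [hL₀r, ← Matrix.mul_assoc, hβhr G.A N G.C hN, Matrix.mul_nonsing_inv_cancel_right _ _ huhd]
  · rw [hM₀, ← Matrix.mul_assoc, hβr Gh.A K Gh.C hK, Matrix.mul_nonsing_inv_cancel_right _ _ hud]
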